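/- For a finite simple connected graph $G$, let $G^2$ (the square of $G$) be the graph on the same vertex set in which two distinct vertices are adjacent if and only if their distance in $G$ is at most $2$, and let $\rho(G)$ be the spectral radius (equivalently, the largest eigenvalue) of the adjacency matrix of $G$. Let $P_n$ and $S_n$ be the path and the star on $n$ vertices (so $S_n = K_{1,n-1}$). Then for every tree $T$ on $n \ge 4$ vertices, $$\rho(P_n^2) \le \rho(T^2) \le \rho(S_n^2).$$ Moreover, $\rho(P_n^2) = \rho(T^2)$ if and only if $T$ is isomorphic to $P_n$, and $\rho(T^2) = \rho(S_n^2)$ if and only if $T$ is isomorphic to $S_n$. -/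

import Mathlib

open scoped ENNReal

namespace SimpleGraph

/-- The square of a graph: two distinct vertices are adjacent when their distance in `G` is at
most `2`. The extended distance is `⊤` for vertices in different components, so those stay
non-adjacent. -/
def square {V : Type*} (G : SimpleGraph V) : SimpleGraph V where
  Adj u v := u ≠ v ∧ G.edist u v ≤ 2
  symm := ⟨fun u v h => ⟨h.1.symm, by rw [SimpleGraph.edist_comm]; exact h.2⟩⟩
  loopless := ⟨fun _ h => h.1 rfl⟩

open Classical in
/-- The spectral radius of a finite graph: the spectral radius, i.e. the supremum of `‖μ‖` over
the complex eigenvalues `μ`, of its adjacency matrix. The spectrum being finite, this is a finite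
element of `[0, ∞]`; as the matrix is symmetric and nonnegative, it is its largest eigenvalue. -/
noncomputable def rho {V : Type*} [Fintype V] (G : SimpleGraph V) : ℝ≥0∞ :=
  spectralRadius ℂ (G.adjMatrix ℂ)

/-- The star on the vertices `0, …, n - 1`, with centre `0`. -/
def star (n : ℕ) (hn : 0 < n) : SimpleGraph (Fin n) :=
  starGraph ⟨0, hn⟩

end SimpleGraph

/-! The spectral radius is the maximum of the quadratic form of the adjacency matrix on unit vectors
(`exists_perron`). For the upper bound, `T.square` lies in the complete graph, which is the square
of the star. Removing edges from a connected graph strictly lowers the radius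
(`Connected.mono_rho`), and a tree with complete square is a star.

For the lower bound, the Perron vector of the square of the path is carried over to `T` with its
norm kept and its energy not lowered. `T` is built up by joining rooted pieces `A` and `B` along an
edge between their roots. At each join the list of weights is polarized: an initial segment is
reflected, and of each mirror pair the larger weight goes to the far side. This does not lower the
energy on the path, and it brings a weight at least as large as the first one to the cut between the
parts for `A` and `B` (`List.exists_path_split`), to which induction applies. Besides the energy,
the induction carries the weight at the root and that of its closed neighbourhood, since these
control the pairs at distance at most `2` created by the new edge (`Dominates`).

For equality, a join with more than one vertex on the root side makes the neighbourhood bound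
strict, and attaching a single new root turns this into strictly more energy. With a non-cut vertex
as last root, the energy is strictly larger or a path from that root spans `T`; a tree spanned by a
path is that path. -/

namespace List

/-! ### Path energy of lists and polarization -/

/-- The first entry of a list of reals, read as `0` on the empty list. -/
def entry₀ (l : List ℝ) : ℝ := l.getD 0 0

/-- The second entry of a list of reals, read as `0` on shorter lists. -/
def entry₁ (l : List ℝ) : ℝ := l.getD 1 0

@[simp] lemma entry₀_nil : entry₀ [] = 0 := rfl
@[simp] lemma entry₁_nil : entry₁ [] = 0 := rfl
@[simp] lemma entry₀_cons (a : ℝ) (l : List ℝ) : entry₀ (a :: l) = a := rfl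
@[simp] lemma entry₁_cons (a : ℝ) (l : List ℝ) : entry₁ (a :: l) = l.entry₀ := rfl

/-- The sum of the products of entries of a list at distance `1` or `2`. -/
def pathEnergy : List ℝ → ℝ
  | [] => 0
  | a :: l => a * (l.entry₀ + l.entry₁) + pathEnergy l

@[simp] lemma pathEnergy_nil : pathEnergy [] = 0 := rfl
@[simp] lemma pathEnergy_cons (a : ℝ) (l : List ℝ) :
    pathEnergy (a :: l) = a * (l.entry₀ + l.entry₁) + pathEnergy l := rfl

/-- The sum of the squares of the entries of a list. -/
def sqSum (l : List ℝ) : ℝ := (l.map (· ^ 2)).sum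

@[simp] lemma sqSum_nil : sqSum [] = 0 := rfl
@[simp] lemma sqSum_cons (a : ℝ) (l : List ℝ) : sqSum (a :: l) = a ^ 2 + sqSum l := by
  simp [sqSum]
@[simp] lemma sqSum_append (l m : List ℝ) : sqSum (l ++ m) = sqSum l + sqSum m := by
  simp [sqSum]
@[simp] lemma sqSum_reverse (l : List ℝ) : sqSum l.reverse = sqSum l := by
  induction l with
  | nil => rfl
  | cons a l ih => simp [ih, add_comm]

lemma entry₀_nonneg {l : List ℝ} (h : ∀ a ∈ l, 0 ≤ a) : 0 ≤ l.entry₀ := by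
  cases l with
  | nil => simp
  | cons a l => exact h a (by simp)

lemma entry₁_nonneg {l : List ℝ} (h : ∀ a ∈ l, 0 ≤ a) : 0 ≤ l.entry₁ := by
  cases l with
  | nil => simp
  | cons a l => exact entry₀_nonneg fun b hb => h b (by simp [hb])

/-- Only three pairs straddle the cut: the two heads, and each head with the other second entry. -/
lemma pathEnergy_reverse_append (l m : List ℝ) :
    pathEnergy (l.reverse ++ m) = pathEnergy l + pathEnergy m
      + m.entry₀ * (l.entry₀ + l.entry₁) + m.entry₁ * l.entry₀ := by
  induction l generalizing m with
  | nil => simp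
  | cons a l ih =>
    rw [reverse_cons, append_assoc, singleton_append, ih]
    simp
    ring

/-- Once `l` and `m` are exhausted, `t` faces the default value `0`; nonnegativity makes `t` the
larger side. -/
lemma entry₀_zipWith_max_append {l m t : List ℝ} (h : l.length = m.length)
    (ht : ∀ a ∈ t, 0 ≤ a) :
    (zipWith max l m ++ t).entry₀ = max l.entry₀ (m ++ t).entry₀ := by
  cases l <;> cases m <;> simp_all [entry₀_nonneg]

lemma entry₁_zipWith_max_append {l m t : List ℝ} (h : l.length = m.length)
    (ht : ∀ a ∈ t, 0 ≤ a) :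
    (zipWith max l m ++ t).entry₁ = max l.entry₁ (m ++ t).entry₁ := by
  cases l <;> cases m <;> simp_all [entry₁_nonneg, entry₀_zipWith_max_append (t := t)]

lemma entry₀_zipWith_min {l m t : List ℝ} (h : l.length = m.length)
    (ht : ∀ a ∈ t, 0 ≤ a) :
    (zipWith min l m).entry₀ = min l.entry₀ (m ++ t).entry₀ := by
  cases l <;> cases m <;> simp_all [entry₀_nonneg]

lemma entry₁_zipWith_min {l m t : List ℝ} (h : l.length = m.length)
    (ht : ∀ a ∈ t, 0 ≤ a) :
    (zipWith min l m).entry₁ = min l.entry₁ (m ++ t).entry₁ := by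
  cases l <;> cases m <;> simp_all [entry₁_nonneg, entry₀_zipWith_min (t := t)]

lemma mul_add_mul_le_min_max (a b c d : ℝ) :
    a * c + b * d ≤ min a b * min c d + max a b * max c d := by
  rcases le_total a b with h | h <;> rcases le_total c d with h' | h' <;>
    simp only [min_eq_left, min_eq_right, max_eq_left, max_eq_right, h, h'] <;>
    nlinarith [mul_nonneg (sub_nonneg.2 h) (sub_nonneg.2 h')]

lemma sqSum_zipWith_min_max {l m : List ℝ} (h : l.length = m.length) :
    sqSum (zipWith min l m) + sqSum (zipWith max l m) = sqSum l + sqSum m := by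
  induction l generalizing m with
  | nil => cases m <;> simp_all
  | cons a l ih =>
    cases m with
    | nil => simp at h
    | cons b m =>
      have := ih (m := m) (by simpa using h)
      rcases le_total a b with h' | h' <;> simp [h'] <;> linarith

/-- Each pair within one half is matched with its mirror image, and the two-term rearrangement
inequality applies to the two products. -/
lemma pathEnergy_le_zipWith {l m t : List ℝ} (h : l.length = m.length) (ht : ∀ a ∈ t, 0 ≤ a) :
    pathEnergy l + pathEnergy (m ++ t) ≤
      pathEnergy (zipWith min l m) + pathEnergy (zipWith max l m ++ t) := by
  induction l generalizing m with
  | nil => cases m <;> simp_all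
  | cons a l ih =>
    cases m with
    | nil => simp at h
    | cons b m =>
      have h' : l.length = m.length := by simpa using h
      have := ih h'
      simp only [zipWith_cons_cons, cons_append, pathEnergy_cons, entry₀_zipWith_min h' ht,
        entry₁_zipWith_min h' ht, entry₀_zipWith_max_append h' ht,
        entry₁_zipWith_max_append h' ht]
      have h0 := mul_add_mul_le_min_max a b l.entry₀ (m ++ t).entry₀
      have h1 := mul_add_mul_le_min_max a b l.entry₁ (m ++ t).entry₁
      linarith

/-- Polarization with respect to a reflection without fixed point increases the path energy. -/
lemma pathEnergy_polarize_even {l m t : List ℝ} (h : l.length = m.length)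
    (ht : ∀ a ∈ t, 0 ≤ a) :
    pathEnergy (l.reverse ++ (m ++ t)) ≤
      pathEnergy ((zipWith min l m).reverse ++ (zipWith max l m ++ t)) := by
  cases l with
  | nil => cases m <;> simp_all
  | cons a l =>
    cases m with
    | nil => simp at h
    | cons b m =>
      have h' : l.length = m.length := by simpa using h
      have := pathEnergy_le_zipWith h' ht
      simp only [pathEnergy_reverse_append, zipWith_cons_cons, cons_append, pathEnergy_cons,
        entry₀_cons, entry₁_cons, entry₀_zipWith_min h' ht,
        entry₁_zipWith_min h' ht, entry₀_zipWith_max_append h' ht,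
        entry₁_zipWith_max_append h' ht]
      have h1 := mul_add_mul_le_min_max a b l.entry₁ (m ++ t).entry₁
      have e1 := min_add_max a b
      have e2 := min_add_max l.entry₀ (m ++ t).entry₀
      have e3 := min_mul_max a b
      -- The pairs of central entries with second entries, on either side, add up to a product of
      -- sums of mirror pairs, which polarization preserves.
      have e4 : (min a b + max a b) * (min l.entry₀ (m ++ t).entry₀ + max l.entry₀ (m ++ t).entry₀)
        = (a + b) * (l.entry₀ + (m ++ t).entry₀) := by rw [e1, e2]
      linarith

/-- Polarization with respect to a reflection with a fixed point increases the path energy. -/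
lemma pathEnergy_polarize_odd {l m t : List ℝ} (c : ℝ) (h : l.length = m.length)
    (ht : ∀ a ∈ t, 0 ≤ a) :
    pathEnergy (l.reverse ++ c :: (m ++ t)) ≤
      pathEnergy ((zipWith min l m).reverse ++ c :: (zipWith max l m ++ t)) := by
  have := pathEnergy_le_zipWith h ht
  simp only [pathEnergy_reverse_append, pathEnergy_cons,
    entry₀_cons, entry₁_cons, entry₀_zipWith_min h ht,
    entry₁_zipWith_min h ht, entry₀_zipWith_max_append h ht,
    entry₁_zipWith_max_append h ht]
  have e0 := min_add_max l.entry₀ (m ++ t).entry₀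
  have e1 := min_add_max l.entry₁ (m ++ t).entry₁
  have e3 := min_mul_max l.entry₀ (m ++ t).entry₀
  have e4 : c * (min l.entry₀ (m ++ t).entry₀ + max l.entry₀ (m ++ t).entry₀)
    = c * (l.entry₀ + (m ++ t).entry₀) := by rw [e0]
  have e5 : c * (min l.entry₁ (m ++ t).entry₁ + max l.entry₁ (m ++ t).entry₁)
    = c * (l.entry₁ + (m ++ t).entry₁) := by rw [e1]
  linarith

lemma zipWith_pos {f : ℝ → ℝ → ℝ} (hf : ∀ a b, 0 < a → 0 < b → 0 < f a b) {l m : List ℝ}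
    (hl : ∀ a ∈ l, 0 < a) (hm : ∀ a ∈ m, 0 < a) : ∀ a ∈ zipWith f l m, 0 < a := by
  induction l generalizing m with
  | nil => simp
  | cons a l ih =>
    cases m with
    | nil => simp
    | cons b m =>
      simp only [mem_cons, forall_eq_or_imp, zipWith_cons_cons] at hl hm ⊢
      exact ⟨hf a b hl.1 hm.1, ih hl.2 hm.2⟩

/-- A list of weights on a path rooted at its end can be redistributed over a path of the same
length which is rooted at a position cutting it into `p` (with the root) and `q`. -/
lemma exists_path_split {x : List ℝ} (hx : ∀ a ∈ x, 0 < a) {a b : ℕ} (ha : 1 ≤ a) (hb : 1 ≤ b)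
    (hab : x.length = a + b) :
    ∃ p q : List ℝ, p.length = a ∧ q.length = b ∧ (∀ a ∈ p, 0 < a) ∧ (∀ a ∈ q, 0 < a) ∧
      sqSum p + sqSum q = sqSum x ∧
      pathEnergy x ≤ pathEnergy p + pathEnergy q
        + p.entry₀ * (q.entry₀ + q.entry₁) + p.entry₁ * q.entry₀ ∧
      x.entry₀ ≤ p.entry₀ ∧ x.entry₀ + x.entry₁ ≤ p.entry₀ + q.entry₀ := by
  -- The reflection exchanges positions `0` and `b`. It has `k` mirror pairs, and `C` holds the
  -- fixed middle entry, if any.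
  obtain ⟨k, hk⟩ : ∃ k, b + 1 = 2 * k ∨ b + 1 = 2 * k + 1 := ⟨(b + 1) / 2, by omega⟩
  obtain ⟨X, C, Y, t, hX, hY, hC, htl, hxe⟩ : ∃ X C Y t : List ℝ, X.length = k ∧ Y.length = k ∧
      C.length = b + 1 - 2 * k ∧ t.length = a - 1 ∧ x = X ++ (C ++ (Y.reverse ++ t)) := by
    refine ⟨x.take k, (x.drop k).take (b + 1 - 2 * k),
      (((x.drop k).drop (b + 1 - 2 * k)).take k).reverse,
      ((x.drop k).drop (b + 1 - 2 * k)).drop k, ?_, ?_, ?_, ?_, ?_⟩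
    · simp; omega
    · simp; omega
    · simp; omega
    · simp; omega
    · simp only [reverse_reverse, take_append_drop]
  have hXp : ∀ a ∈ X, 0 < a := fun a h => hx a (by simp [hxe, h])
  have hYp : ∀ a ∈ Y, 0 < a := fun a h => hx a (by simp [hxe, h])
  have hCp : ∀ a ∈ C, 0 < a := fun a h => hx a (by simp [hxe, h])
  have htp : ∀ a ∈ t, 0 < a := fun a h => hx a (by simp [hxe, h])
  have hlen : X.length = Y.length := hX.trans hY.symm
  have hmin := zipWith_pos (f := min) (fun a b h h' => lt_min h h') hXp hYp
  have hmax := zipWith_pos (f := max) (fun a b h _ => lt_max_of_lt_left h) hXp hYp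
  have hsq := sqSum_zipWith_min_max hlen
  have key : pathEnergy x ≤
      pathEnergy (zipWith min X Y ++ (C ++ ((zipWith max X Y).reverse ++ t))) := by
    have hr : X.reverse.length = Y.reverse.length := by simp [hlen]
    have ht0 : ∀ a ∈ t, 0 ≤ a := fun a h => (htp a h).le
    rcases hk with hk | hk
    · have hC0 : C = [] := by rw [← length_eq_zero_iff]; omega
      have := pathEnergy_polarize_even hr ht0
      rw [← reverse_zipWith hlen, ← reverse_zipWith hlen] at this
      simpa [hxe, hC0] using this
    · obtain ⟨c, hc⟩ : ∃ c, C = [c] := by rw [← length_eq_one_iff]; omega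
      have := pathEnergy_polarize_odd c hr ht0
      rw [← reverse_zipWith hlen, ← reverse_zipWith hlen] at this
      simpa [hxe, hc] using this
  cases X with
  | nil => simp at hX; omega
  | cons x0 X =>
  cases Y with
  | nil => simp at hY; omega
  | cons y0 Y =>
  simp only [zipWith_cons_cons] at hmin hmax key hsq
  -- The polarized list is cut before position `b`, where `max x0 y0` now sits; `q` is the initial
  -- part read backwards from the cut.
  refine ⟨max x0 y0 :: t, zipWith max X Y ++ (C.reverse ++ (min x0 y0 :: zipWith min X Y).reverse),
    ?_, ?_, ?_, ?_, ?_, ?_, ?_, ?_⟩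
  · simp; omega
  · simp at hX hY ⊢; omega
  · grind
  · grind
  · rw [hxe]
    simp at hsq ⊢
    linarith
  · refine key.trans (le_of_eq ?_)
    have := pathEnergy_reverse_append (zipWith max X Y ++ (C.reverse ++
      (min x0 y0 :: zipWith min X Y).reverse)) (max x0 y0 :: t)
    rw [show pathEnergy (max x0 y0 :: t) + pathEnergy (zipWith max X Y ++ (C.reverse ++
      (min x0 y0 :: zipWith min X Y).reverse)) = pathEnergy (zipWith max X Y ++ (C.reverse ++
      (min x0 y0 :: zipWith min X Y).reverse)) + pathEnergy (max x0 y0 :: t) from add_comm _ _,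
      ← this]
    simp
  · simp [hxe]
  · rw [hxe]
    cases X with
    | cons x1 X =>
      cases Y with
      | nil => simp at hX hY; omega
      | cons y1 Y =>
        simp
        linarith [le_max_left x0 y0, le_max_left x1 y1]
    | nil =>
      cases Y with
      | cons y1 Y => simp at hX hY; omega
      | nil =>
        cases C with
        | cons c C =>
          have : C = [] := by rw [← length_eq_zero_iff]; simp at hC; omega
          simp [this]
        | nil => simp [max_add_min]

end List

/-! ### Squares of graphs and their quadratic forms -/

namespace SimpleGraph

variable {V W : Type*}

lemma square_adj {G : SimpleGraph V} {u v : V} :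
    G.square.Adj u v ↔ u ≠ v ∧ (G.Adj u v ∨ ∃ w, G.Adj u w ∧ G.Adj w v) := by
  change u ≠ v ∧ G.edist u v ≤ 2 ↔ _
  refine and_congr_right fun huv => ?_
  rw [← not_lt, two_lt_edist_iff]
  simp only [huv, ne_eq, not_false_eq_true, true_and, not_and_or, not_not,
    Set.eq_empty_iff_forall_notMem, not_forall, mem_commonNeighbors]
  simp only [adj_comm G v, not_or, not_not]

lemma le_square (G : SimpleGraph V) : G ≤ G.square := fun _ _ h =>
  square_adj.2 ⟨h.ne, .inl h⟩

open Classical in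
/-- The bilinear form of the adjacency matrix of a graph. -/
noncomputable def adjForm [Fintype V] (G : SimpleGraph V) (y z : V → ℝ) : ℝ :=
  ∑ u, ∑ v, if G.Adj u v then y u * z v else 0

open Classical in
/-- The sum of the values of a function over the neighbours of a vertex. -/
noncomputable def nbrSum [Fintype V] (G : SimpleGraph V) (y : V → ℝ) (u : V) : ℝ :=
  ∑ v, if G.Adj u v then y v else 0

section Form
variable [Fintype V] (G : SimpleGraph V)

lemma adjForm_eq_sum_mul_nbrSum (y z : V → ℝ) :
    G.adjForm y z = ∑ u, y u * G.nbrSum z u := by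
  simp only [adjForm, nbrSum, Finset.mul_sum, mul_ite, mul_zero]

lemma adjForm_comm (y z : V → ℝ) : G.adjForm y z = G.adjForm z y := by
  unfold adjForm
  rw [Finset.sum_comm]
  refine Finset.sum_congr rfl fun u _ => Finset.sum_congr rfl fun v _ => ?_
  by_cases h : G.Adj u v
  · simp [h, h.symm, mul_comm]
  · simp [h, G.adj_comm v u]

lemma nbrSum_add (y z : V → ℝ) (u : V) : G.nbrSum (y + z) u = G.nbrSum y u + G.nbrSum z u := by
  simp only [nbrSum, ← Finset.sum_add_distrib]
  refine Finset.sum_congr rfl fun v _ => ?_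
  split_ifs <;> simp

lemma adjForm_add_add (y z : V → ℝ) :
    G.adjForm (y + z) (y + z) = G.adjForm y y + G.adjForm z z + 2 * G.adjForm y z := by
  have h : G.adjForm (y + z) (y + z) =
      G.adjForm y y + G.adjForm y z + (G.adjForm z y + G.adjForm z z) := by
    simp only [adjForm_eq_sum_mul_nbrSum, nbrSum_add, Pi.add_apply, ← Finset.sum_add_distrib]
    exact Finset.sum_congr rfl fun u _ => by ring
  rw [h, adjForm_comm G z y]
  ring

lemma nbrSum_nonneg {y : V → ℝ} (hy : ∀ v, 0 ≤ y v) (u : V) : 0 ≤ G.nbrSum y u :=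
  Finset.sum_nonneg fun v _ => by split_ifs <;> simp [hy v]

lemma le_nbrSum {y : V → ℝ} (hy : ∀ v, 0 ≤ y v) {u v : V} (h : G.Adj u v) :
    y v ≤ G.nbrSum y u := by
  classical
  have : (if G.Adj u v then y v else 0) ≤ G.nbrSum y u := by
    unfold nbrSum
    convert Finset.single_le_sum (f := fun w => if G.Adj u w then y w else 0)
      (fun w _ => by split_ifs <;> simp [hy w]) (Finset.mem_univ v)
  simpa [h] using this

/-- The interaction in the square of a graph of two functions with disjoint supports `A ∋ r` and
`B ∋ s`, where `r` and `s` are adjacent. -/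
lemma le_adjForm_square {A B : Finset V} (hAB : Disjoint A B) {r s : V} (hr : r ∈ A) (hs : s ∈ B)
    (hrs : G.Adj r s) {y z : V → ℝ} (hy : ∀ v, 0 ≤ y v) (hz : ∀ v, 0 ≤ z v)
    (hyA : ∀ v ∉ A, y v = 0) (hzB : ∀ v ∉ B, z v = 0) :
    y r * (z s + G.nbrSum z s) + G.nbrSum y r * z s ≤ G.square.adjForm y z := by
  classical
  have e : y r * (z s + G.nbrSum z s) + G.nbrSum y r * z s =
      ∑ u, ∑ v, ((if u = r then y u else 0) * (if v = s then z v else 0)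
        + (if u = r then y u else 0) * (if G.Adj s v then z v else 0)
        + (if G.Adj r u then y u else 0) * (if v = s then z v else 0)) := by
    simp only [Finset.sum_add_distrib, ← Finset.sum_mul_sum]
    simp [nbrSum]
    ring
  rw [e]
  refine Finset.sum_le_sum fun u _ => Finset.sum_le_sum fun v _ => ?_
  by_cases hu : u ∈ A
  swap; · simp [hyA u hu]
  by_cases hv : v ∈ B
  swap; · simp [hzB v hv]
  have huv : u ≠ v := fun h => Finset.disjoint_left.1 hAB hu (h ▸ hv)
  have hyz := mul_nonneg (hy u) (hz v)
  by_cases hur : u = r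
  · subst hur
    by_cases hvs : v = s
    · subst hvs
      simp [(le_square G) hrs]
    · by_cases hsv : G.Adj s v
      · have : G.square.Adj u v := square_adj.2 ⟨huv, .inr ⟨s, hrs, hsv⟩⟩
        simp [hvs, hsv, this]
      · simp only [hvs, hsv, if_false, mul_zero, add_zero]
        split_ifs <;> simp [hyz]
  · by_cases hru : G.Adj r u
    · by_cases hvs : v = s
      · subst hvs
        have : G.square.Adj u v := square_adj.2 ⟨huv, .inr ⟨r, hru.symm, hrs⟩⟩
        simp [hur, hru, this]
      · simp only [hvs, hur, if_false, mul_zero, zero_mul, add_zero]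
        split_ifs <;> simp [hyz]
    · simp only [hur, hru, if_false, zero_mul, add_zero]
      split_ifs <;> simp [hyz]

end Form

/-! ### Rooted pieces -/

/-- The vertex sets that arise, together with a root, from single vertices by joining the roots of
two disjoint rooted sets by an edge of the graph. -/
inductive RootedPiece [DecidableEq V] (G : SimpleGraph V) : Finset V → V → Prop
  | single (r : V) : RootedPiece G {r} r
  | join {A B : Finset V} {r s : V} : RootedPiece G A r → RootedPiece G B s → Disjoint A B →
      G.Adj r s → RootedPiece G (A ∪ B) r

namespace RootedPiece
variable [DecidableEq V] {G : SimpleGraph V} {S : Finset V} {r : V}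

lemma root_mem (h : RootedPiece G S r) : r ∈ S := by
  induction h with
  | single r => simp
  | join _ _ _ _ ih _ => exact Finset.mem_union_left _ ih

lemma insert (h : RootedPiece G S r) {u w : V} (hu : u ∈ S) (hw : w ∉ S) (huw : G.Adj u w) :
    RootedPiece G (Insert.insert w S) r := by
  induction h with
  | single r =>
    obtain rfl : u = r := by simpa using hu
    rw [Finset.insert_eq, Finset.union_comm]
    exact .join (.single u) (.single w) (by simpa using huw.ne) huw
  | @join A B r s hA hB hAB hrs ihA ihB =>
    rw [Finset.mem_union, not_or] at hw
    rcases Finset.mem_union.1 hu with h | h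
    · rw [← Finset.insert_union]
      exact .join (ihA h hw.1) hB (by simp [hAB, hw.2]) hrs
    · rw [← Finset.union_insert]
      exact .join hA (ihB h hw.2) (by simp [hAB, hw.1]) hrs

lemma exists_of_connected_induce [Fintype V] {D : Set V} (hD : (G.induce D).Connected) {s : V}
    (hs : s ∈ D) : ∃ S : Finset V, (∀ v, v ∈ S ↔ v ∈ D) ∧ RootedPiece G S s := by
  classical
  -- A largest piece inside `D` must be all of `D`, since otherwise an edge leaving it would extend
  -- it.
  obtain ⟨S, hS, hmax⟩ := Finset.exists_max_image
    (Finset.univ.filter fun S : Finset V => RootedPiece G S s ∧ ∀ v ∈ S, v ∈ D) Finset.card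
    ⟨{s}, by simp [RootedPiece.single, hs]⟩
  obtain ⟨hSp, hSD⟩ := (Finset.mem_filter.1 hS).2
  refine ⟨S, fun v => ⟨hSD v, fun hv => ?_⟩, hSp⟩
  by_contra hvS
  obtain ⟨p⟩ := hD.preconnected ⟨s, hs⟩ ⟨v, hv⟩
  obtain ⟨d, -, h1, h2⟩ := p.exists_boundary_dart {w | w.1 ∈ S} hSp.root_mem hvS
  have := hmax (Insert.insert d.snd.1 S) (by
    simp only [Finset.mem_filter, Finset.mem_univ, true_and]
    refine ⟨hSp.insert h1 h2 d.adj, fun v hv => ?_⟩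
    rcases Finset.mem_insert.1 hv with rfl | hv
    · exact d.snd.2
    · exact hSD v hv)
  rw [Finset.card_insert_of_notMem h2] at this
  omega

end RootedPiece

/-! ### Transplanting weights from a path to a graph -/

/-- There is a path of `G` with the vertex set `S` that starts at `r`. -/
def IsSpannedByPathFrom (G : SimpleGraph V) (S : Finset V) (r : V) : Prop :=
  ∃ t, ∃ p : G.Walk r t, p.IsPath ∧ ∀ v, v ∈ p.support ↔ v ∈ S

/-- The weights `y` on `S` do at least as well for the square of `G` as the weights `x` do for the
square of a path, also as regards attaching more vertices to the root `r`. -/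
structure Dominates [Fintype V] (G : SimpleGraph V) (S : Finset V) (r : V) (x : List ℝ)
    (y : V → ℝ) : Prop where
  pos : ∀ v ∈ S, 0 < y v
  eq_zero : ∀ v ∉ S, y v = 0
  sum_sq : ∑ v, y v ^ 2 = x.sqSum
  root : x.entry₀ ≤ y r
  near_root : x.entry₀ + x.entry₁ ≤ y r + G.nbrSum y r
  energy : 2 * x.pathEnergy ≤ G.square.adjForm y y

namespace Dominates
variable [Fintype V] [DecidableEq V] {G : SimpleGraph V} {A B S : Finset V} {r s : V}
  {p q x : List ℝ} {y z : V → ℝ}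

lemma nonneg (h : Dominates G S r x y) (v : V) : 0 ≤ y v := by
  by_cases hv : v ∈ S
  · exact (h.pos v hv).le
  · exact (h.eq_zero v hv).ge

/-- Unprimed letters stand for list entries, primed ones for root weights and neighbour sums. The
last term on the left retains the slack at the root of the second piece, so that strictness can be
passed on. -/
lemma cross_le {a b c d a' b' c' d' : ℝ} (hd : 0 ≤ d') (hab0 : 0 ≤ b)
    (hc' : 0 ≤ c') (ha : a ≤ a') (hab : a + b ≤ a' + b') (hc : c ≤ c') :
    a * (c + d) + b * c + a * (c' + d' - (c + d)) ≤ a' * (c' + d') + b' * c' := by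
  nlinarith [mul_nonneg (sub_nonneg.2 ha) hd, mul_nonneg (sub_nonneg.2 hab) hc',
    mul_nonneg hab0 (sub_nonneg.2 hc)]

lemma join_energy (hA : Dominates G A r p y) (hB : Dominates G B s q z) (hAB : Disjoint A B)
    (hr : r ∈ A) (hs : s ∈ B) (hrs : G.Adj r s) (hp : ∀ a ∈ p, 0 < a) :
    G.square.adjForm y y + G.square.adjForm z z + 2 * (p.entry₀ * (q.entry₀ + q.entry₁)
      + p.entry₁ * q.entry₀ + p.entry₀ * (z s + G.nbrSum z s - (q.entry₀ + q.entry₁))) ≤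
      G.square.adjForm (y + z) (y + z) := by
  rw [adjForm_add_add]
  have h1 := le_adjForm_square G hAB hr hs hrs hA.nonneg hB.nonneg hA.eq_zero hB.eq_zero
  have hp' : ∀ a ∈ p, 0 ≤ a := fun a h => (hp a h).le
  have h2 := cross_le (d := q.entry₁) (G.nbrSum_nonneg hB.nonneg s)
    (List.entry₁_nonneg hp') (hB.nonneg s) hA.root hA.near_root hB.root
  linarith

lemma nbrSum_join (hA : Dominates G A r p y) (hB : Dominates G B s q z) (hrs : G.Adj r s) :
    p.entry₀ + p.entry₁ + q.entry₀ ≤ y r + G.nbrSum (y + z) r := by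
  rw [nbrSum_add]
  linarith [hA.near_root, hB.root, G.le_nbrSum hB.nonneg hrs]

lemma join (hA : Dominates G A r p y) (hB : Dominates G B s q z) (hAB : Disjoint A B)
    (hr : r ∈ A) (hs : s ∈ B) (hrs : G.Adj r s) (hp : ∀ a ∈ p, 0 < a)
    (hsq : p.sqSum + q.sqSum = x.sqSum) 
    (hE : x.pathEnergy ≤ p.pathEnergy + q.pathEnergy
        + p.entry₀ * (q.entry₀ + q.entry₁) + p.entry₁ * q.entry₀)
    (h0 : x.entry₀ ≤ p.entry₀) (h1 : x.entry₀ + x.entry₁ ≤ p.entry₀ + q.entry₀) :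
    Dominates G (A ∪ B) r x (y + z) where
  pos v hv := by
    rcases Finset.mem_union.1 hv with h | h
    · exact add_pos_of_pos_of_nonneg (hA.pos v h) (hB.nonneg v)
    · exact add_pos_of_nonneg_of_pos (hA.nonneg v) (hB.pos v h)
  eq_zero v hv := by
    rw [Finset.mem_union, not_or] at hv
    simp [hA.eq_zero v hv.1, hB.eq_zero v hv.2]
  sum_sq := by
    rw [← hsq, ← hA.sum_sq, ← hB.sum_sq, ← Finset.sum_add_distrib]
    refine Finset.sum_congr rfl fun v _ => ?_
    by_cases hv : v ∈ A
    · simp [hB.eq_zero v (Finset.disjoint_left.1 hAB hv)]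
    · simp [hA.eq_zero v hv]
  root := by
    have := hB.nonneg r
    have := hA.root
    simp only [Pi.add_apply]
    linarith
  near_root := by
    have := hB.nonneg r
    have := nbrSum_join hA hB hrs
    have := List.entry₁_nonneg fun a h => (hp a h).le
    simp only [Pi.add_apply]
    linarith
  energy := by
    have h2 := join_energy hA hB hAB hr hs hrs hp
    have h3 := mul_nonneg (List.entry₀_nonneg fun a h => (hp a h).le)
      (sub_nonneg.2 hB.near_root)
    linarith [hA.energy, hB.energy]

end Dominates

lemma IsSpannedByPathFrom.cons [DecidableEq V] {G : SimpleGraph V} {B : Finset V} {r s : V}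
    (h : G.IsSpannedByPathFrom B s) (hr : r ∉ B) (hrs : G.Adj r s) :
    G.IsSpannedByPathFrom ({r} ∪ B) r := by
  obtain ⟨t, p, hp, hpB⟩ := h
  refine ⟨t, .cons hrs p, hp.cons (by rwa [hpB]), fun v => ?_⟩
  simp [hpB]

variable [Fintype V] [DecidableEq V] {G : SimpleGraph V}

lemma dominates_single (r : V) {a : ℝ} (ha : 0 < a) :
    Dominates G {r} r [a] (Pi.single r a) where
  pos v hv := by
    obtain rfl : v = r := by simpa using hv
    simpa
  eq_zero v hv := by
    simp only [Finset.mem_singleton] at hv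
    simp [hv]
  sum_sq := by simp [Pi.single_apply, ite_pow]
  root := by simp
  near_root := by
    have : (0 : ℝ) ≤ G.nbrSum (Pi.single r a) r := G.nbrSum_nonneg (fun v => by
      rw [Pi.single_apply]; split_ifs <;> simp [ha.le]) r
    simpa using this
  energy := by
    simp only [List.pathEnergy_cons, List.entry₀_nil, List.entry₁_nil, List.pathEnergy_nil,
      add_zero, mul_zero]
    refine Finset.sum_nonneg fun u _ => Finset.sum_nonneg fun v _ => ?_
    simp only [Pi.single_apply]
    split_ifs <;> simp [mul_self_nonneg]

/-- Joining a single new root to a dominating piece. -/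
lemma exists_dominates_singleton_union {B : Finset V} {r s : V} (hs : s ∈ B)
    (hr : r ∉ B) (hrs : G.Adj r s) {a : ℝ} {q : List ℝ} {z : V → ℝ} (ha : 0 < a)
    (hB : Dominates G B s q z)
    (hz : G.IsSpannedByPathFrom B s ∨ q.entry₀ + q.entry₁ < z s + G.nbrSum z s ∨
        2 * q.pathEnergy < G.square.adjForm z z) :
    ∃ y, Dominates G ({r} ∪ B) r (a :: q) y ∧ (G.IsSpannedByPathFrom ({r} ∪ B) r ∨
      2 * (a :: q).pathEnergy < G.square.adjForm y y) := by
  have hA := dominates_single (G := G) r ha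
  have hd : Disjoint {r} B := by simpa using hr
  have hp : ∀ b ∈ [a], 0 < b := by simpa
  refine ⟨_, hA.join hB hd (by simp) hs hrs hp (by simp) (by simp; linarith) (by simp) (by simp),
    ?_⟩
  rcases hz with hz | hz | hz
  · exact .inl (hz.cons hr hrs)
  all_goals
    right
    have h2 := hA.join_energy hB hd (by simp) hs hrs hp
    have h3 := hA.energy
    have h4 := hB.energy
    simp at h2 h3 ⊢
  · have h5 := mul_pos ha (sub_pos.2 hz)
    linarith
  · have h5 := mul_nonneg ha.le (sub_nonneg.2 hB.near_root)
    linarith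

lemma RootedPiece.exists_dominates {S : Finset V} {r : V} (h : RootedPiece G S r) {x : List ℝ}
    (hx : ∀ a ∈ x, 0 < a) (hxS : x.length = S.card) :
    ∃ y, Dominates G S r x y ∧ (G.IsSpannedByPathFrom S r ∨
      x.entry₀ + x.entry₁ < y r + G.nbrSum y r ∨
        2 * x.pathEnergy < G.square.adjForm y y) := by
  induction h generalizing x with
  | single r =>
    obtain ⟨a, rfl⟩ := List.length_eq_one_iff.1 (by simpa using hxS)
    exact ⟨_, dominates_single r (hx a (by simp)), .inl ⟨r, .nil, .nil, by simp⟩⟩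
  | @join A B r s hA hB hAB hrs ihA ihB =>
    have hr := hA.root_mem
    have hs := hB.root_mem
    rw [Finset.card_union_of_disjoint hAB] at hxS
    -- A singleton `A` takes the head of the list, so nothing is rearranged and a spanning path or a
    -- gain in `B` is passed on. A larger `A` gains `p.entry₁ > 0` in the neighbourhood bound.
    by_cases hA1 : A.card = 1
    · obtain ⟨r', rfl⟩ := Finset.card_eq_one.1 hA1
      obtain rfl : r = r' := by simpa using hr
      cases x with
      | nil => simp at hxS; omega
      | cons a q =>
        obtain ⟨z, hz, hz'⟩ := ihB (x := q) (fun b hb => hx b (by simp [hb]))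
          (by simp at hxS; omega)
        obtain ⟨y, hy, hy'⟩ := exists_dominates_singleton_union hs (by simpa using hAB) hrs
          (hx a (by simp)) hz hz'
        exact ⟨y, hy, hy'.imp_right .inr⟩
    · have hAc := Finset.card_pos.2 ⟨r, hr⟩
      obtain ⟨p, q, hpA, hqB, hp, hq, hsq, hE, h0, h1⟩ := List.exists_path_split hx
        hAc (Finset.card_pos.2 ⟨s, hs⟩) hxS
      obtain ⟨y, hy, -⟩ := ihA hp hpA
      obtain ⟨z, hz, -⟩ := ihB hq hqB
      refine ⟨y + z, hy.join hz hAB hr hs hrs hp hsq hE h0 h1, .inr (.inl ?_)⟩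
      have h2 := hy.nbrSum_join hz hrs
      have h3 := hz.nonneg r
      have h4 : 0 < p.entry₁ := by
        match p, hp with
        | [], _ => simp at hpA; omega
        | [_], _ => simp at hpA; omega
        | _ :: b :: _, hp => exact hp b (by simp)
      simp only [Pi.add_apply]
      linarith

lemma Connected.exists_dominates [Nontrivial V] (hG : G.Connected) {x : List ℝ}
    (hx : ∀ a ∈ x, 0 < a) (hxV : x.length = Fintype.card V) :
    ∃ r, ∃ y, Dominates G Finset.univ r x y ∧ (G.IsSpannedByPathFrom Finset.univ r ∨
        2 * x.pathEnergy < G.square.adjForm y y) := by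
  -- Rooting at a non-cut vertex makes the last join one with a singleton, where slack in the
  -- neighbourhood bound becomes slack in the energy.
  obtain ⟨r, hr⟩ := hG.exists_connected_induce_compl_singleton_of_finite_nontrivial
  obtain ⟨s, hrs⟩ := hG.preconnected.exists_adj_of_nontrivial r
  obtain ⟨B, hB, hBs⟩ := RootedPiece.exists_of_connected_induce hr (s := s) (by simpa using hrs.ne')
  have hrB : r ∉ B := by simp [hB]
  have hu : {r} ∪ B = Finset.univ := by
    ext v
    simp [hB, em]
  cases x with
  | nil => simp at hxV; exact absurd hxV.symm Fintype.card_ne_zero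
  | cons a q =>
    have hc : q.length = B.card := by
      rw [← Finset.card_univ, ← hu, ← Finset.insert_eq, Finset.card_insert_of_notMem hrB] at hxV
      simpa using hxV
    obtain ⟨z, hz, hz'⟩ := hBs.exists_dominates (x := q) (fun b hb => hx b (by simp [hb])) hc
    obtain ⟨y, hy, hy'⟩ := exists_dominates_singleton_union hBs.root_mem hrB hrs
      (hx a (by simp)) hz hz'
    rw [hu] at hy hy'
    exact ⟨r, y, hy, hy'⟩

end SimpleGraph

/-! ### The spectral radius as the maximum of the form -/

namespace SimpleGraph

variable {V W : Type*} [Fintype V] [Fintype W] (G : SimpleGraph V)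

lemma adjForm_single_right (y : V → ℝ) [DecidableEq V] (v : V) (t : ℝ) :
    G.adjForm y (Pi.single v t) = t * G.nbrSum y v := by
  rw [adjForm_comm, adjForm_eq_sum_mul_nbrSum, Finset.sum_eq_single v]
  · simp
  · intro u _ hu
    simp [hu]
  · simp

lemma nbrSum_eq_of_adjForm_eq {c : ℝ} (h : ∀ y, G.adjForm y y ≤ c * ∑ v, y v ^ 2) {x : V → ℝ}
    (hx : G.adjForm x x = c * ∑ v, x v ^ 2) (v : V) : G.nbrSum x v = c * x v := by
  classical
  set d := G.nbrSum x v - c * x v with hd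
  -- Perturbing coordinate `v` by `t` gives `2 * t * d ≤ c * t ^ 2`; this `t` is small enough to
  -- force `d = 0`.
  set t := d / (|c| + 1) with ht
  have hc : 0 < |c| + 1 := by positivity
  have htd : d = t * (|c| + 1) := by rw [ht]; field_simp
  have h1 := h (x + Pi.single v t)
  have h2 : G.adjForm (Pi.single v t) (Pi.single v t) = 0 := by
    rw [adjForm_single_right]
    refine mul_eq_zero_of_right _ (Finset.sum_eq_zero fun u _ => ?_)
    by_cases hu : u = v
    · simp [hu]
    · simp [hu]
  have h3 : ∑ u, (x + Pi.single v t : V → ℝ) u ^ 2 = ∑ u, x u ^ 2 + (2 * t * x v + t ^ 2) := by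
    rw [← Finset.add_sum_erase _ _ (Finset.mem_univ v),
      ← Finset.add_sum_erase Finset.univ (fun u => x u ^ 2) (Finset.mem_univ v),
      Finset.sum_congr rfl fun u hu => by
        rw [Pi.add_apply, Pi.single_eq_of_ne (Finset.ne_of_mem_erase hu), add_zero]]
    simp
    ring
  rw [adjForm_add_add, h2, adjForm_single_right, h3, hx] at h1
  have h4 : 2 * t * d ≤ c * t ^ 2 := by rw [hd]; linarith
  have h5 : t ^ 2 * (2 * (|c| + 1) - c) ≤ 0 := by rw [htd] at h4; linarith
  have h6 : 0 < 2 * (|c| + 1) - c := by linarith [le_abs_self c]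
  have h7 : t = 0 := by
    by_contra hne
    have := mul_pos (by positivity : 0 < t ^ 2) h6
    linarith
  have h8 : d = 0 := by rw [htd, h7, zero_mul]
  linarith

lemma continuous_adjForm : Continuous fun y : V → ℝ => G.adjForm y y := by
  unfold adjForm
  refine continuous_finsetSum _ fun u _ => continuous_finsetSum _ fun v _ => ?_
  split_ifs <;> fun_prop

lemma adjForm_le_abs (y : V → ℝ) : G.adjForm y y ≤ G.adjForm |y| |y| := by
  refine Finset.sum_le_sum fun u _ => Finset.sum_le_sum fun v _ => ?_
  split_ifs
  · simpa [abs_mul] using le_abs_self (y u * y v)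
  · rfl

lemma adjForm_nonneg {y : V → ℝ} (hy : ∀ v, 0 ≤ y v) : 0 ≤ G.adjForm y y := by
  refine Finset.sum_nonneg fun u _ => Finset.sum_nonneg fun v _ => ?_
  split_ifs
  · exact mul_nonneg (hy u) (hy v)
  · rfl

/-- A maximizer of the adjacency form on the unit sphere which is nonnegative. -/
lemma exists_nonneg_maximizer [Nonempty V] : ∃ (c : ℝ) (x : V → ℝ), 0 ≤ c ∧ (∀ v, 0 ≤ x v) ∧
    ∑ v, x v ^ 2 = 1 ∧ (∀ v, G.nbrSum x v = c * x v) ∧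
    ∀ y, G.adjForm y y ≤ c * ∑ v, y v ^ 2 := by
  classical
  let K : Set (V → ℝ) := {x | (∀ v, 0 ≤ x v) ∧ ∑ v, x v ^ 2 = 1}
  have hKc : IsCompact K := by
    refine (isCompact_univ_pi fun _ : V => isCompact_Icc (a := (0 : ℝ)) (b := 1)).of_isClosed_subset
      ?_ ?_
    · refine IsClosed.inter ?_ (isClosed_eq (by fun_prop) continuous_const)
      change IsClosed {x : V → ℝ | ∀ v, 0 ≤ x v}
      rw [Set.ofPred_forall]
      exact isClosed_iInter fun v => isClosed_le continuous_const (continuous_apply v)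
    · intro x hx v _
      refine ⟨hx.1 v, ?_⟩
      have := Finset.single_le_sum (f := fun u => x u ^ 2) (fun u _ => sq_nonneg _)
        (Finset.mem_univ v)
      rw [hx.2] at this
      exact (sq_le_one_iff₀ (hx.1 v)).1 this
  have hKn : K.Nonempty := by
    obtain ⟨v⟩ := ‹Nonempty V›
    refine ⟨Pi.single v 1, fun u => ?_, ?_⟩
    · rw [Pi.single_apply]; split_ifs <;> simp
    · simp [Pi.single_apply, ite_pow]
  obtain ⟨x, hx, hmax⟩ := hKc.exists_isMaxOn hKn G.continuous_adjForm.continuousOn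
  have hb : ∀ y, G.adjForm y y ≤ G.adjForm x x * ∑ v, y v ^ 2 := by
    intro y
    by_cases hy0 : ∑ v, y v ^ 2 = 0
    · have : y = 0 := by
        rw [Finset.sum_eq_zero_iff_of_nonneg fun v _ => sq_nonneg _] at hy0
        ext v
        simpa using hy0 v (Finset.mem_univ v)
      simp [this, adjForm]
    have hs : 0 < ∑ v, y v ^ 2 :=
      lt_of_le_of_ne (Finset.sum_nonneg fun v _ => sq_nonneg _) (Ne.symm hy0)
    set n := ∑ v, y v ^ 2 with hn
    have hsq : √n ^ 2 = n := Real.sq_sqrt hs.le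
    have hmem : (fun v => (√n)⁻¹ * |y v|) ∈ K := by
      refine ⟨fun v => by positivity, ?_⟩
      simp only [mul_pow, inv_pow, sq_abs, ← Finset.mul_sum, hsq, ← hn]
      field_simp
    have h1 := hmax hmem
    have h2 : G.adjForm (fun v => (√n)⁻¹ * |y v|) (fun v => (√n)⁻¹ * |y v|) =
        n⁻¹ * G.adjForm |y| |y| := by
      have hi : n⁻¹ = (√n)⁻¹ ^ 2 := by rw [inv_pow, hsq]
      rw [hi]
      unfold adjForm
      simp only [Finset.mul_sum]
      refine Finset.sum_congr rfl fun u _ => Finset.sum_congr rfl fun v _ => ?_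
      split_ifs
      · simp only [Pi.abs_apply]; ring
      · simp
    have h1' : n⁻¹ * G.adjForm |y| |y| ≤ G.adjForm x x := h2 ▸ h1
    rw [inv_mul_le_iff₀ hs, mul_comm] at h1'
    exact (G.adjForm_le_abs y).trans h1'
  exact ⟨_, x, G.adjForm_nonneg hx.1, hx.1, hx.2,
    G.nbrSum_eq_of_adjForm_eq hb (by rw [hx.2, mul_one]), hb⟩

open Classical in
lemma adjMatrix_mulVec_ofReal (x : V → ℝ) (v : V) :
    ((G.adjMatrix ℂ).mulVec fun u => (x u : ℂ)) v = (G.nbrSum x v : ℂ) := by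
  simp [Matrix.mulVec, dotProduct, adjMatrix_apply, nbrSum, Complex.ofReal_sum,
    apply_ite Complex.ofReal]

open Classical in
lemma mem_spectrum_adjMatrix_iff {k : ℂ} : k ∈ spectrum ℂ (G.adjMatrix ℂ) ↔
    ∃ z : V → ℂ, z ≠ 0 ∧ (G.adjMatrix ℂ).mulVec z = k • z := by
  rw [spectrum.mem_iff, Matrix.isUnit_iff_isUnit_det, isUnit_iff_ne_zero, not_not,
    ← Matrix.exists_mulVec_eq_zero_iff]
  refine exists_congr fun z => and_congr_right fun _ => ?_
  rw [Matrix.sub_mulVec, sub_eq_zero, eq_comm, Algebra.algebraMap_eq_smul_one,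
    Matrix.smul_mulVec, Matrix.one_mulVec]

lemma rho_eq_ofReal {c : ℝ} (hc : 0 ≤ c) {x : V → ℝ} (hx : ∑ v, x v ^ 2 = 1)
    (hxc : ∀ v, G.nbrSum x v = c * x v) (h : ∀ y, G.adjForm y y ≤ c * ∑ v, y v ^ 2) :
    G.rho = ENNReal.ofReal c := by
  classical
  unfold rho spectralRadius
  apply le_antisymm
  · refine iSup₂_le fun k hk => ?_
    obtain ⟨z, hz0, hz⟩ := (G.mem_spectrum_adjMatrix_iff (k := k)).1 (by convert hk)
    -- By the triangle inequality, the moduli of a complex eigenvector test the real form.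
    have h1 : ∀ v, ‖k‖ * ‖z v‖ ≤ G.nbrSum (fun u => ‖z u‖) v := by
      intro v
      have := congrFun hz v
      rw [← norm_mul, ← smul_eq_mul, ← Pi.smul_apply, ← this]
      refine (norm_sum_le _ _).trans (le_of_eq ?_)
      refine Finset.sum_congr rfl fun u _ => ?_
      by_cases huv : G.Adj v u <;> simp [adjMatrix_apply, huv]
    have h2 := h fun u => ‖z u‖
    rw [adjForm_eq_sum_mul_nbrSum] at h2
    have h3 : ‖k‖ * ∑ v, ‖z v‖ ^ 2 ≤ c * ∑ v, ‖z v‖ ^ 2 := by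
      refine le_trans ?_ h2
      rw [Finset.mul_sum]
      refine Finset.sum_le_sum fun v _ => ?_
      have := mul_le_mul_of_nonneg_left (h1 v) (norm_nonneg (z v))
      linarith
    obtain ⟨v, hv⟩ := Function.ne_iff.1 hz0
    have h4 : 0 < ∑ v, ‖z v‖ ^ 2 := Finset.sum_pos' (fun v _ => sq_nonneg _)
      ⟨v, Finset.mem_univ v, by have := norm_pos_iff.2 hv; positivity⟩
    rw [← enorm_eq_nnnorm, ← ofReal_norm k]
    exact ENNReal.ofReal_le_ofReal (le_of_mul_le_mul_right h3 h4)
  · have hk : (c : ℂ) ∈ spectrum ℂ (G.adjMatrix ℂ) := by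
      refine G.mem_spectrum_adjMatrix_iff.2 ⟨fun v => (x v : ℂ), fun h0 => ?_, ?_⟩
      · have : ∀ v, x v = 0 := fun v => by simpa using congrFun h0 v
        simp [this] at hx
      · ext v
        rw [adjMatrix_mulVec_ofReal, hxc]
        simp
    refine le_trans (le_of_eq ?_) (le_iSup₂ (c : ℂ) (by convert hk))
    rw [← enorm_eq_nnnorm, ← ofReal_norm, Complex.norm_real, Real.norm_of_nonneg hc]

/-- The spectral radius of a finite graph as the maximum of the adjacency form. -/
lemma exists_perron [Nonempty V] : ∃ (c : ℝ) (x : V → ℝ), 0 ≤ c ∧ (∀ v, 0 ≤ x v) ∧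
    ∑ v, x v ^ 2 = 1 ∧ (∀ v, G.nbrSum x v = c * x v) ∧
    (∀ y, G.adjForm y y ≤ c * ∑ v, y v ^ 2) ∧ G.rho = ENNReal.ofReal c := by
  obtain ⟨c, x, hc, hx0, hx1, hxc, h⟩ := G.exists_nonneg_maximizer
  exact ⟨c, x, hc, hx0, hx1, hxc, h, G.rho_eq_ofReal hc hx1 hxc h⟩

variable {G}

lemma adjForm_eq_of_eigenvector {c : ℝ} {x : V → ℝ} (hxc : ∀ v, G.nbrSum x v = c * x v) :
    G.adjForm x x = c * ∑ v, x v ^ 2 := by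
  rw [adjForm_eq_sum_mul_nbrSum, Finset.mul_sum]
  exact Finset.sum_congr rfl fun v _ => by rw [hxc]; ring

lemma Connected.eigenvector_pos (hG : G.Connected) {c : ℝ} {x : V → ℝ} (hx0 : ∀ v, 0 ≤ x v)
    (hx1 : ∑ v, x v ^ 2 = 1) (hxc : ∀ v, G.nbrSum x v = c * x v) (v : V) : 0 < x v := by
  have hstep : ∀ u w, G.Adj u w → x u = 0 → x w = 0 := fun u w huw hu =>
    le_antisymm (by simpa [hxc, hu] using G.le_nbrSum hx0 huw) (hx0 w)
  refine lt_of_le_of_ne (hx0 v) fun hv => ?_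
  have : ∀ w, x w = 0 := by
    intro w
    obtain ⟨p⟩ := hG.preconnected v w
    induction p with
    | nil => exact hv.symm
    | cons h _ ih => exact ih (hstep _ _ h hv.symm).symm
  simp [this] at hx1

lemma Iso.rho_eq {H : SimpleGraph W} (e : G ≃g H) : G.rho = H.rho := by
  classical
  cases isEmpty_or_nonempty V with
  | inl hV =>
    have : IsEmpty W := e.symm.toEquiv.isEmpty
    simp only [rho, spectralRadius, spectrum.of_subsingleton]
  | inr hV =>
    obtain ⟨c, x, hc, -, hx1, hxc, h, hG⟩ := G.exists_perron
    rw [hG]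
    have hn : ∀ (y : W → ℝ) (v : V), H.nbrSum y (e v) = G.nbrSum (y ∘ e) v := by
      intro y v
      unfold nbrSum
      rw [← e.toEquiv.sum_comp]
      refine Finset.sum_congr rfl fun u _ => ?_
      have : H.Adj (e v) (e u) ↔ G.Adj v u := e.map_adj_iff
      simp [this]
    symm
    refine H.rho_eq_ofReal hc (x := x ∘ e.symm) ?_ ?_ ?_
    · rw [← hx1]
      exact e.symm.toEquiv.sum_comp fun v => x v ^ 2
    · intro w
      obtain ⟨v, rfl⟩ := e.surjective w
      rw [hn, Function.comp_assoc]
      simp [Function.comp_def, hxc]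
    · intro y
      have := h (y ∘ e)
      rw [adjForm_eq_sum_mul_nbrSum] at this ⊢
      rw [← e.toEquiv.sum_comp, ← e.toEquiv.sum_comp fun w => y w ^ 2]
      simpa [hn] using this

lemma Connected.mono_rho {H : SimpleGraph V} (hH : H.Connected) (h : G ≤ H) :
    G.rho ≤ H.rho ∧ (G.rho = H.rho → G = H) := by
  have := hH.nonempty
  obtain ⟨c, x, hc, hx0, hx1, hxc, -, hG⟩ := G.exists_perron
  obtain ⟨d, -, hd, -, -, -, hy, hHr⟩ := H.exists_perron
  have hle : ∀ u v, (0 : ℝ) ≤ x u * x v := fun u v => mul_nonneg (hx0 u) (hx0 v)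
  have h1 : G.adjForm x x ≤ H.adjForm x x := by
    refine Finset.sum_le_sum fun u _ => Finset.sum_le_sum fun v _ => ?_
    split_ifs with h1 h2
    · rfl
    · exact absurd (h h1) h2
    · exact hle u v
    · rfl
  have h2 := adjForm_eq_of_eigenvector hxc
  have h3 := hy x
  rw [hx1, mul_one] at h2 h3
  rw [hG, hHr, ENNReal.ofReal_le_ofReal_iff hd, ENNReal.ofReal_eq_ofReal_iff hc hd]
  refine ⟨by linarith, fun hcd => ?_⟩
  -- If the radii agree, the Perron vector of `G` maximizes the form of `H` too, so it is a positive
  -- eigenvector of `H`; an extra edge at `u` would raise its neighbour sum there.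
  have h4 := H.nbrSum_eq_of_adjForm_eq hy (x := x) (by rw [hx1]; linarith)
  have h5 := hH.eigenvector_pos hx0 hx1 h4
  refine le_antisymm h fun u v huv => ?_
  by_contra hne
  refine (ne_of_lt ?_) ((hxc u).trans ((congrArg (· * x u) hcd).trans (h4 u).symm))
  refine Finset.sum_lt_sum (fun w _ => ?_) ⟨v, Finset.mem_univ v, by simp [hne, huv, h5 v]⟩
  split_ifs with h1 h2
  · rfl
  · exact absurd (h h1) h2
  · exact hx0 w
  · rfl

end SimpleGraph

/-! ### Stars, paths and the equality cases -/

namespace SimpleGraph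

variable {V W : Type*} {G : SimpleGraph V}

lemma Iso.square {H : SimpleGraph W} (e : G ≃g H) : Nonempty (G.square ≃g H.square) := by
  refine ⟨⟨e.toEquiv, ?_⟩⟩
  intro u v
  change H.square.Adj (e u) (e v) ↔ _
  rw [square_adj, square_adj, e.surjective.exists]
  simp [e.map_adj_iff]

lemma Iso.rho_square_eq [Fintype V] [Fintype W] {H : SimpleGraph W} (e : G ≃g H) :
    G.square.rho = H.square.rho :=
  e.square.elim fun e => e.rho_eq

lemma IsTree.eq_of_le (hG : G.IsTree) {H : SimpleGraph V} (hH : H.Connected) (h : H ≤ G) :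
    H = G :=
  le_antisymm h ((isTree_iff_minimal_connected.1 hG).2 hH h)

lemma starGraph_square (c : V) : (starGraph c).square = ⊤ := by
  ext u v
  rw [square_adj, top_adj, and_iff_left_iff_imp]
  intro huv
  by_cases hu : u = c
  · exact .inl (starGraph_adj.2 ⟨huv, .inl hu⟩)
  by_cases hv : v = c
  · exact .inl (starGraph_adj.2 ⟨huv, .inr hv⟩)
  · exact .inr ⟨c, starGraph_adj.2 ⟨hu, .inr rfl⟩, starGraph_adj.2 ⟨Ne.symm hv, .inl rfl⟩⟩

/-- A tree whose square is complete is a star, centred at the neighbour of any leaf. -/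
lemma IsTree.exists_eq_starGraph [Fintype V] [Nontrivial V] (hG : G.IsTree)
    (h : G.square = ⊤) : ∃ c, G = starGraph c := by
  classical
  obtain ⟨u, hu⟩ := hG.exists_vert_degree_one_of_nontrivial
  obtain ⟨c, huc, hc⟩ := degree_eq_one_iff_existsUnique_adj.1 hu
  refine ⟨c, (hG.eq_of_le (connected_starGraph c) ?_).symm⟩
  have key : ∀ v, v ≠ c → G.Adj c v := by
    intro v hvc
    by_cases hvu : u = v
    · exact hvu ▸ huc.symm
    · have : G.square.Adj u v := by rw [h]; exact hvu
      rcases (square_adj.1 this).2 with h1 | ⟨w, h1, h2⟩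
      · exact absurd (hc v h1) hvc
      · exact hc w h1 ▸ h2
  intro v w hvw
  obtain ⟨hne, rfl | rfl⟩ := starGraph_adj.1 hvw
  · exact key w hne.symm
  · exact (key v hne).symm

lemma nonempty_starGraph_iso (e : V ≃ W) (c : V) (d : W) :
    Nonempty (starGraph c ≃g starGraph d) := by
  classical
  refine ⟨⟨e.trans (Equiv.swap (e c) d), ?_⟩⟩
  intro u v
  have h : ∀ w, (e.trans (Equiv.swap (e c) d)) w = d ↔ w = c := fun w => by
    rw [← (e.trans (Equiv.swap (e c) d)).apply_eq_iff_eq (x := w)]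
    simp
  simp only [starGraph_adj, h, ne_eq, EmbeddingLike.apply_eq_iff_eq]

lemma IsTree.nonempty_iso_pathGraph [Fintype V] (hG : G.IsTree) {r : V}
    (h : G.IsSpannedByPathFrom Finset.univ r) :
    Nonempty (G ≃g pathGraph (Fintype.card V)) := by
  classical
  obtain ⟨t, p, hp, hps⟩ := h
  have hlen : p.length + 1 = Fintype.card V := by
    rw [← Walk.length_support, ← List.toFinset_card_of_nodup hp.support_nodup, ← Finset.card_univ]
    congr 1
    ext v
    simp [hps]
  rw [← hlen]
  have hbij : Function.Bijective p.pathGraphHom := by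
    rw [Fintype.bijective_iff_surjective_and_card]
    refine ⟨fun v => ?_, by simp [hlen]⟩
    obtain ⟨i, hi, hiv⟩ := List.getElem_of_mem ((hps v).2 (Finset.mem_univ v))
    exact ⟨⟨i, by simpa using hi⟩, hiv⟩
  let e := Equiv.ofBijective _ hbij
  -- The spanning path is a connected spanning subgraph, and a tree is minimal among these.
  have he : (pathGraph (p.length + 1)).map e.toEmbedding = G := by
    refine hG.eq_of_le ?_ ?_
    · exact (Iso.map e _).connected_iff.1 (pathGraph_connected _)
    · rw [map_le_iff_le_comap]
      intro i j hij
      exact p.pathGraphHom.map_adj hij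
  have transfer : ∀ H : SimpleGraph V, H = G → ∀ m, Nonempty (H ≃g pathGraph m) →
      Nonempty (G ≃g pathGraph m) := by
    rintro _ rfl m h
    exact h
  exact transfer _ he _ ⟨(Iso.map e _).symm⟩

lemma pathGraph_square_adj {n : ℕ} {i j : Fin n} (h : (pathGraph n).square.Adj i j) :
    i.val < j.val ∧ j.val ≤ i.val + 2 ∨ j.val < i.val ∧ i.val ≤ j.val + 2 := by
  obtain ⟨hne, h⟩ := square_adj.1 h
  have := Fin.val_ne_of_ne hne
  rcases h with h | ⟨w, h1, h2⟩
  · rw [pathGraph_adj] at h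
    omega
  · rw [pathGraph_adj] at h1 h2
    omega

lemma sum_ofFn_near {n : ℕ} (x : Fin n → ℝ) :
    (∑ j : Fin n, if j.val + 1 ≤ 2 then x j else 0) =
      (List.ofFn x).entry₀ + (List.ofFn x).entry₁ := by
  match n, x with
  | 0, x => simp
  | 1, x => simp
  | n + 2, x => simp [Fin.sum_univ_succ]

lemma sum_near_eq_pathEnergy {n : ℕ} (x : Fin n → ℝ) :
    (∑ i : Fin n, ∑ j : Fin n, if i.val < j.val ∧ j.val ≤ i.val + 2 then x i * x j else 0) =
      (List.ofFn x).pathEnergy := by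
  induction n with
  | zero => simp
  | succ n ih =>
    rw [List.ofFn_succ, List.pathEnergy_cons, ← sum_ofFn_near, ← ih, Fin.sum_univ_succ,
      Fin.sum_univ_succ]
    simp [Fin.sum_univ_succ (n := n), Finset.mul_sum]

lemma adjForm_pathGraph_square_le {n : ℕ} {x : Fin n → ℝ} (hx : ∀ i, 0 ≤ x i) :
    (pathGraph n).square.adjForm x x ≤ 2 * (List.ofFn x).pathEnergy := by
  rw [two_mul, ← sum_near_eq_pathEnergy]
  -- `adjForm` runs over ordered pairs and the path energy over increasing ones; the second copy
  -- serves the decreasing pairs.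
  nth_rw 2 [Finset.sum_comm]
  unfold adjForm
  simp only [← Finset.sum_add_distrib]
  refine Finset.sum_le_sum fun i _ => Finset.sum_le_sum fun j _ => ?_
  have := mul_nonneg (hx i) (hx j)
  have := mul_nonneg (hx j) (hx i)
  split_ifs with h h1 h2 h2 <;> first | linarith | skip
  have := pathGraph_square_adj h
  omega

lemma Connected.square (hG : G.Connected) : G.square.Connected :=
  hG.mono G.le_square

lemma Connected.rho_pathGraph_square_le [Fintype V] [Nontrivial V] (hG : G.Connected) :
    (pathGraph (Fintype.card V)).square.rho ≤ G.square.rho ∧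
      ((pathGraph (Fintype.card V)).square.rho = G.square.rho →
        ∃ r, G.IsSpannedByPathFrom Finset.univ r) := by
  classical
  have hP : (pathGraph (Fintype.card V)).square.Connected := by
    obtain ⟨n, hn⟩ := Nat.exists_eq_succ_of_ne_zero (Fintype.card_ne_zero (α := V))
    rw [hn]
    exact (pathGraph_connected n).square
  have := hP.nonempty
  obtain ⟨c, x, hc, hx0, hx1, hxc, -, hPr⟩ := exists_perron (pathGraph (Fintype.card V)).square
  obtain ⟨d, -, hd, -, -, -, hy, hGr⟩ := exists_perron G.square
  have hpos := hP.eigenvector_pos hx0 hx1 hxc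
  obtain ⟨r, y, hyx, hyr⟩ := hG.exists_dominates (x := List.ofFn x)
    (by simpa [List.mem_ofFn] using hpos) (by simp)
  have h1 : ∑ v, y v ^ 2 = 1 := by
    rw [hyx.sum_sq, ← hx1, List.sqSum, List.map_ofFn, List.sum_ofFn]
    rfl
  have h2 := hy y
  have h3 := adjForm_pathGraph_square_le hx0
  rw [adjForm_eq_of_eigenvector hxc, hx1] at h3
  rw [h1] at h2
  rw [hPr, hGr, ENNReal.ofReal_le_ofReal_iff hd, ENNReal.ofReal_eq_ofReal_iff hc hd]
  have h4 := hyx.energy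
  refine ⟨by linarith, fun hcd => ⟨r, hyr.resolve_right fun h5 => ?_⟩⟩
  linarith

lemma IsTree.nonempty_iso_starGraph_iff [Fintype V] [Nontrivial V] (hG : G.IsTree)
    (e : V ≃ W) (d : W) : Nonempty (G ≃g starGraph d) ↔ G.square = ⊤ := by
  classical
  constructor
  · rintro ⟨f⟩
    obtain ⟨g⟩ := f.square
    rw [starGraph_square] at g
    ext u v
    rw [← g.map_adj_iff]
    simp
  · intro h
    obtain ⟨c, rfl⟩ := hG.exists_eq_starGraph h
    exact nonempty_starGraph_iso e c d

end SimpleGraph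

theorem corollary3p5 {V : Type*} [Fintype V] (T : SimpleGraph V) (hT : T.IsTree)
    (n : ℕ) (hn : 4 ≤ n) (hV : Fintype.card V = n) :
    ((SimpleGraph.pathGraph n).square.rho ≤ T.square.rho ∧
      T.square.rho ≤ (SimpleGraph.star n (Nat.zero_lt_of_lt hn)).square.rho) ∧
    ((SimpleGraph.pathGraph n).square.rho = T.square.rho ↔
      Nonempty (T ≃g SimpleGraph.pathGraph n)) ∧
    (T.square.rho = (SimpleGraph.star n (Nat.zero_lt_of_lt hn)).square.rho ↔
      Nonempty (T ≃g SimpleGraph.star n (Nat.zero_lt_of_lt hn))) := by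
  classical
  subst hV
  have : Nontrivial V := Fintype.one_lt_card_iff_nontrivial.1 (by omega)
  obtain ⟨hP, hPeq⟩ := hT.connected.rho_pathGraph_square_le
  let e := Fintype.equivFin V
  let d : Fin (Fintype.card V) := ⟨0, Nat.zero_lt_of_lt hn⟩
  obtain ⟨f⟩ := SimpleGraph.nonempty_starGraph_iso e (e.symm d) d
  have hS : (SimpleGraph.starGraph d).square.rho = (⊤ : SimpleGraph V).rho := by
    rw [← f.rho_square_eq, SimpleGraph.starGraph_square]
  obtain ⟨hle, heq⟩ := SimpleGraph.connected_top.mono_rho (le_top : T.square ≤ ⊤)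
  change (_ ∧ _ ≤ (SimpleGraph.starGraph d).square.rho) ∧ _ ∧
    (_ = (SimpleGraph.starGraph d).square.rho ↔ Nonempty (T ≃g SimpleGraph.starGraph d))
  rw [hS, hT.nonempty_iso_starGraph_iff e d]
  refine ⟨⟨hP, hle⟩, ⟨fun h => ?_, fun ⟨g⟩ => g.rho_square_eq.symm⟩, heq, fun h => by rw [h]⟩
  obtain ⟨r, hr⟩ := hPeq h
  exact hT.nonempty_iso_pathGraph hr
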